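/- Graphs are finite and may have parallel edges and loops. A half-edge of $G=(V,E)$ at a vertex $v$ is a pair $(v,e)$ with $e$ an edge incident with $v$, a loop at $v$ giving two half-edges at $v$; $G$ is $k$-regular if every vertex has exactly $k$ half-edges. A proper edge $k$-colouring of $G$ is a map $E\to\{0,\dots,k-1\}$ under which distinct half-edges at a vertex always have different colours (so a graph with a loop has none), and $P(L(G);k)$ denotes the number of proper edge $k$-colourings of $G$, i.e. the chromatic polynomial of the line graph $L(G)$ evaluated at $k$. Number the vertices of $G$ as $1,\dots,2n$. The sign $\mathrm{sgn}(M)\in\{1,-1\}$ of a perfect matching $M=\{u_1v_1,\dots,u_nv_n\}$ with $u_i<v_i$ for all $i$ is the sign of the permutation $\begin{pmatrix}1&2&\cdots&2n-1&2n\\u_1&v_1&\cdots&u_n&v_n\end{pmatrix}$. Given a multiplicative abelian group $\Gamma$ with identity $1$ and an element of order two denoted $-1$, a Pfaffian labelling of $G$ is a map $\ell:E\to\Gamma$ such that $\prod_{e\in M}\ell(e)=\mathrm{sgn}(M)$ for every perfect matching $M$ of $G$. $G$ admits a Pfaffian labelling if such a numbering, $\Gamma$, $-1$ and $\ell$ exist.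 **Theorem.** Let $k$ be odd and let $G=(V,E)$ be a $k$-regular graph that admits a Pfaffian labelling. Then to each family of linear orders $<$ on the sets of half-edges at the vertices $v\in V$ there can be assigned a sign $\varepsilon(<)\in\{1,-1\}$ such that for every integer $q\ge k$ $$\varepsilon(<)\,P(L(G);k)=q^{-|E|}\sum_{y\in\{0,1,\dots,q-1\}^E}\ \prod_{v\in V}\ \prod_{(v,e)<(v,f)}2\sin\frac{\pi(y_f-y_e)}{q},$$ where the inner product is over the pairs of half-edges at $v$ with $(v,e)<(v,f)$. The sign depends only on the orders up to even permutation: if for each $v$ a permutation $\pi_v$ of the half-edges at $v$ carries the order $<$ at $v$ to the order $<'$ at $v$, then $\varepsilon(<')=\varepsilon(<)\prod_{v\in V}\mathrm{sgn}(\pi_v)$. -/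

import Mathlib

open scoped Graph

namespace Graph

variable {α β : Type*}

/-- The half-edges of the multigraph `G` at the vertex `v`: an edge that joins `v` to another vertex
contributes one half-edge at `v`, a loop at `v` contributes two (told apart by the second
component). -/
def HalfEdge (G : Graph α β) (v : V(G)) : Type _ :=
  {p : E(G) × Bool // G.Inc p.1 v ∧ (p.2 = true → G.IsLoopAt p.1 v)}

/-- The edge that a half-edge belongs to. -/
def HalfEdge.edge {G : Graph α β} {v : V(G)} (h : G.HalfEdge v) : E(G) := h.1.1

noncomputable instance (G : Graph α β) [Fintype E(G)] (v : V(G)) : Fintype (G.HalfEdge v) :=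
  Fintype.ofInjective (fun h : G.HalfEdge v => (h.1 : E(G) × Bool)) Subtype.val_injective

/-- Every vertex has degree `k`, loops being counted twice. -/
def IsRegular (G : Graph α β) (k : ℕ) : Prop :=
  ∀ v : V(G), Nat.card (G.HalfEdge v) = k

/-- A proper edge colouring: distinct half-edges at a vertex have distinct colours. For a loopless
graph this says that distinct edges with a common end have distinct colours; a graph with a loop
has no proper edge colouring. -/
def IsProperEdgeColoring (G : Graph α β) {C : Type*} (c : E(G) → C) : Prop :=
  ∀ v : V(G), Function.Injective fun h : G.HalfEdge v => c h.edge

/-- The number of proper edge colourings with the colours `0, …, k - 1`, that is, the value at `k` of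
the chromatic polynomial of the line graph of `G`. -/
noncomputable def numProperEdgeColorings (G : Graph α β) (k : ℕ) : ℕ :=
  Nat.card {c : E(G) → Fin k // G.IsProperEdgeColoring c}

/-- A perfect matching: a set of edges that has exactly one half-edge at every vertex (so it contains
no loop). -/
def IsPerfectMatching (G : Graph α β) (M : Finset E(G)) : Prop :=
  ∀ v : V(G), ∃! h : G.HalfEdge v, h.edge ∈ M

/-- Let `ν` number the vertices. The permutation `π`, read as the word
`π(0,0) π(0,1) π(1,0) π(1,1) … π(n-1,0) π(n-1,1)` (through the order isomorphism `finProdFinEquiv`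
of the lexicographic order on `Fin n × Fin 2` with `Fin (n * 2)`), lists the matching `M` edge by edge,
the smaller end of every edge first. -/
def ListsMatching (G : Graph α β) {n : ℕ} (ν : Fin (n * 2) ≃ V(G)) (M : Finset E(G))
    (π : Equiv.Perm (Fin (n * 2))) : Prop :=
  ∀ i : Fin n, π (finProdFinEquiv (i, 0)) < π (finProdFinEquiv (i, 1)) ∧
    ∃ e ∈ M, G.IsLink e (ν (π (finProdFinEquiv (i, 0)))) (ν (π (finProdFinEquiv (i, 1))))

/-- `l` is a Pfaffian labelling of `G` by the abelian group `Γ`, in which `negOne` plays the part of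
`-1`, for the numbering `ν` of the vertices: the labels of every perfect matching `M` multiply
to the sign of `M`, which is the sign of any permutation that lists `M`. -/
def IsPfaffianLabelling (G : Graph α β) {n : ℕ} (ν : Fin (n * 2) ≃ V(G))
    {Γ : Type*} [CommGroup Γ] (negOne : Γ) (l : E(G) → Γ) : Prop :=
  orderOf negOne = 2 ∧
    ∀ M : Finset E(G), G.IsPerfectMatching M →
      ∀ π : Equiv.Perm (Fin (n * 2)), G.ListsMatching ν M π →
        ∏ e ∈ M, l e = if Equiv.Perm.sign π = 1 then 1 else negOne

end Graph

universe u v w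

/-- `G` admits a Pfaffian labelling by some abelian group with an element of order two. -/
def Graph.AdmitsPfaffianLabelling {α : Type u} {β : Type v} (G : Graph α β) : Prop :=
  ∃ (n : ℕ) (ν : Fin (n * 2) ≃ V(G)) (Γ : Type w) (_ : CommGroup Γ) (negOne : Γ)
    (l : E(G) → Γ), G.IsPfaffianLabelling ν negOne l

/-! For k = 2m + 1 the sine product at a vertex is a Vandermonde determinant in exp(iθ), shifted to
the frequencies -m, …, m. Mixing each frequency with its negative makes the entries real, cos + sin,
up to a constant κ with κ² = ±1 (`exists_prod_two_sin_eq_det_hartley`). Expanding the determinants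
at all vertices gives a signed sum over families of bijections from half-edges to colours. For a
fixed family the sum over y factors over the edges, and orthogonality (`sum_hartley_mul_hartley`,
where q ≥ k enters) leaves q^|E| if the two halves of every edge agree in colour, and 0 otherwise
(`sum_prod_hartley_halfEdge`). What remains is κ^|V| q^|E| times a signed count of proper
colourings.

Colour classes are perfect matchings, and the relative sign of two colourings is the product of the
signs of all their classes (`sign_listings_mul_sign_colorings`). A Pfaffian labelling turns the
product of the class signs of one colouring into the product of all edge labels, which is the same
for every colouring; hence all colourings count with one sign. As |V| is even, κ^|V| is a sign too.
-/

/-! ### Hartley kernels: orthogonality and the sine product as a determinant. -/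

section Trigonometry

/-- The Hartley kernel `cos + sin` at the frequencies `-m, …, m`. -/
noncomputable def hartley (m : ℕ) (a : Fin (2 * m + 1)) (θ : ℝ) : ℝ :=
  Real.cos (((a : ℝ) - m) * θ) + Real.sin (((a : ℝ) - m) * θ)

theorem sum_exp_int_mul (q : ℕ) (hq : 0 < q) (d : ℤ) :
    ∑ t : Fin q, Complex.exp ((d * (2 * Real.pi * (t : ℕ) / q) : ℝ) * Complex.I) =
      if (q : ℤ) ∣ d then (q : ℂ) else 0 := by
  have hq' : (q : ℂ) ≠ 0 := by exact_mod_cast hq.ne'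
  set z : ℂ := Complex.exp (2 * Real.pi * Complex.I * (d / q)) with hz
  have hterm : ∀ t : ℕ, Complex.exp ((d * (2 * Real.pi * (t : ℕ) / q) : ℝ) * Complex.I) = z ^ t := by
    intro t
    rw [hz, ← Complex.exp_nat_mul]
    congr 1
    push_cast
    ring
  have hzq : z ^ q = 1 := by
    rw [hz, ← Complex.exp_nat_mul, Complex.exp_eq_one_iff]
    exact ⟨d, by field_simp⟩
  rw [Fin.sum_univ_eq_sum_range
    (fun t => Complex.exp ((d * (2 * Real.pi * (t : ℕ) / q) : ℝ) * Complex.I)) q]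
  simp_rw [hterm]
  have hz1 : z = 1 ↔ (q : ℤ) ∣ d := by
    rw [hz, Complex.exp_eq_one_iff]
    have h2 := Complex.two_pi_I_ne_zero
    constructor
    · rintro ⟨n, hn⟩
      refine ⟨n, ?_⟩
      have : (d / q : ℂ) = n := by
        apply mul_left_cancel₀ h2
        rw [hn]; ring
      rw [div_eq_iff hq'] at this
      have h3 : (d : ℂ) = ((q * n : ℤ) : ℂ) := by rw [this]; push_cast; ring
      exact_mod_cast h3
    · rintro ⟨n, rfl⟩
      refine ⟨n, ?_⟩
      push_cast
      field_simp
  split_ifs with h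
  · rw [hz1.2 h]; simp
  · have := geom_sum_mul z q
    rw [hzq, sub_self] at this
    exact (mul_eq_zero.1 this).resolve_right (sub_ne_zero.2 fun h' => h (hz1.1 h'))

theorem sum_cos_int_mul (q : ℕ) (hq : 0 < q) (d : ℤ) :
    ∑ t : Fin q, Real.cos (d * (2 * Real.pi * (t : ℕ) / q)) =
      if (q : ℤ) ∣ d then (q : ℝ) else 0 := by
  have := congrArg Complex.re (sum_exp_int_mul q hq d)
  rw [Complex.re_sum] at this
  simp_rw [Complex.exp_ofReal_mul_I_re] at this
  rw [this]
  split_ifs <;> simp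

theorem sum_sin_int_mul (q : ℕ) (hq : 0 < q) (d : ℤ) :
    ∑ t : Fin q, Real.sin (d * (2 * Real.pi * (t : ℕ) / q)) = 0 := by
  have := congrArg Complex.im (sum_exp_int_mul q hq d)
  rw [Complex.im_sum] at this
  simp_rw [Complex.exp_ofReal_mul_I_im] at this
  rw [this]
  split_ifs <;> simp

/-- The product of two kernels is the cosine of the frequency difference plus the sine of the
frequency sum. Sines always sum to zero, and the difference is less than q in absolute value. Plain
characters would pair a with -a instead of a with a. -/
theorem sum_hartley_mul_hartley (m q : ℕ) (hq : 2 * m + 1 ≤ q) (a b : Fin (2 * m + 1)) :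
    ∑ t : Fin q, hartley m a (2 * Real.pi * (t : ℕ) / q) * hartley m b (2 * Real.pi * (t : ℕ) / q) =
      if a = b then (q : ℝ) else 0 := by
  have hterm : ∀ θ : ℝ, hartley m a θ * hartley m b θ =
      Real.cos ((((a : ℤ) - (b : ℤ) : ℤ) : ℝ) * θ) +
        Real.sin ((((a : ℤ) + (b : ℤ) - 2 * m : ℤ) : ℝ) * θ) := by
    intro θ
    have h1 : (((a : ℤ) - (b : ℤ) : ℤ) : ℝ) * θ = ((a : ℝ) - m) * θ - ((b : ℝ) - m) * θ := by
      push_cast; ring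
    have h2 : (((a : ℤ) + (b : ℤ) - 2 * m : ℤ) : ℝ) * θ = ((a : ℝ) - m) * θ + ((b : ℝ) - m) * θ := by
      push_cast; ring
    rw [h1, h2, Real.cos_sub, Real.sin_add, hartley, hartley]
    ring
  simp_rw [hterm]
  rw [Finset.sum_add_distrib, sum_cos_int_mul q (by omega), sum_sin_int_mul q (by omega), add_zero]
  have : ((q : ℤ) ∣ (a : ℤ) - (b : ℤ)) ↔ a = b := by
    constructor
    · intro h
      have ha := a.2
      have hb := b.2
      have h0 := Int.eq_zero_of_abs_lt_dvd h (by rw [abs_lt]; omega)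
      ext; omega
    · rintro rfl; simp
  simp only [this]

/-- The matrix that turns the characters `-m, …, m` into the Hartley kernels. -/
noncomputable def hartleyMatrix (k : ℕ) : Matrix (Fin k) (Fin k) ℂ :=
  ((1 - Complex.I) / 2) • 1 + ((1 + Complex.I) / 2) • (1 : Matrix (Fin k) (Fin k) ℂ).submatrix id Fin.rev

/-- The matrix is a square root of the reversal permutation matrix, whose determinant is ±1. -/
theorem det_hartleyMatrix_sq (k : ℕ) :
    (hartleyMatrix k).det ^ 2 = 1 ∨ (hartleyMatrix k).det ^ 2 = -1 := by
  set J : Matrix (Fin k) (Fin k) ℂ := (1 : Matrix (Fin k) (Fin k) ℂ).submatrix id Fin.rev with hJ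
  have hJJ : J * J = 1 := by
    ext i j
    simp [hJ, Matrix.mul_apply, Matrix.one_apply]
  have hdetJ : J.det = 1 ∨ J.det = -1 := by
    have := congrArg Matrix.det hJJ
    rw [Matrix.det_mul, Matrix.det_one] at this
    exact mul_self_eq_one_iff.1 this
  have hI := Complex.I_sq
  have hg : hartleyMatrix k * hartleyMatrix k = J := by
    rw [hartleyMatrix, ← hJ, add_mul, mul_add, mul_add]
    simp only [Matrix.smul_mul, Matrix.mul_smul, one_mul, mul_one, hJJ, smul_smul]
    ext i j
    simp only [Matrix.add_apply, Matrix.smul_apply, smul_eq_mul]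
    linear_combination ((1 : Matrix (Fin k) (Fin k) ℂ) i j / 2 - J i j / 2) * hI
  rw [sq, ← Matrix.det_mul, hg]
  exact hdetJ

theorem ofReal_hartley (m : ℕ) (a : Fin (2 * m + 1)) (θ : ℝ) :
    (hartley m a θ : ℂ) =
      Complex.exp (((a : ℂ) - m) * θ * Complex.I) * ((1 - Complex.I) / 2) +
        Complex.exp (((Fin.rev a : Fin (2 * m + 1)) - m : ℂ) * θ * Complex.I) *
          ((1 + Complex.I) / 2) := by
  have hrev : (((Fin.rev a : Fin (2 * m + 1)) : ℕ) : ℂ) = 2 * m - (a : ℂ) := by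
    have h : ((Fin.rev a : Fin (2 * m + 1)) : ℕ) + (a : ℕ) = 2 * m := by
      rw [Fin.val_rev]; omega
    rw [eq_sub_iff_add_eq]
    exact_mod_cast h
  have h2 : (((Fin.rev a : Fin (2 * m + 1)) : ℕ) - m : ℂ) * θ * Complex.I =
      (-(((a : ℂ) - m) * θ)) * Complex.I := by
    rw [hrev]; ring
  rw [h2, Complex.exp_mul_I, Complex.exp_mul_I, Complex.cos_neg, Complex.sin_neg, hartley]
  push_cast
  linear_combination Complex.sin (((a : ℂ) - m) * θ) * Complex.I_sq

theorem two_sin_eq_exp (s t : ℝ) :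
    ((2 * Real.sin ((t - s) / 2) : ℝ) : ℂ) =
      -Complex.I * (Complex.exp (-(s / 2) * Complex.I) * Complex.exp (-(t / 2) * Complex.I)) *
        (Complex.exp (t * Complex.I) - Complex.exp (s * Complex.I)) := by
  have h1 : Complex.exp (-(s / 2) * Complex.I) * Complex.exp (-(t / 2) * Complex.I) *
      Complex.exp (t * Complex.I) = Complex.exp ((t - s) / 2 * Complex.I) := by
    rw [← Complex.exp_add, ← Complex.exp_add]; congr 1; ring
  have h2 : Complex.exp (-(s / 2) * Complex.I) * Complex.exp (-(t / 2) * Complex.I) *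
      Complex.exp (s * Complex.I) = Complex.exp (-((t - s) / 2) * Complex.I) := by
    rw [← Complex.exp_add, ← Complex.exp_add]; congr 1; ring
  push_cast
  rw [Complex.sin]
  linear_combination Complex.I * h1 - Complex.I * h2

/-- The product of half-angle sines is, up to a fourth root of unity that depends on `m` only, a
determinant of Hartley kernels. -/
theorem exists_prod_two_sin_eq_det_hartley (m : ℕ) :
    ∃ κ : ℂ, (κ ^ 2 = 1 ∨ κ ^ 2 = -1) ∧ ∀ θ : Fin (2 * m + 1) → ℝ,
      ((∏ i, ∏ j ∈ Finset.Ioi i, 2 * Real.sin ((θ j - θ i) / 2) : ℝ) : ℂ) =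
        κ * ((Matrix.of fun a i => hartley m a (θ i)).det : ℝ) := by
  set k := 2 * m + 1 with hk
  set N := ∑ i : Fin k, (Finset.Ioi i).card with hN
  have hdet := det_hartleyMatrix_sq k
  have hdet0 : (hartleyMatrix k).det ≠ 0 := by
    rintro h; rw [h] at hdet; norm_num at hdet
  refine ⟨(-Complex.I) ^ N * ((hartleyMatrix k).det)⁻¹, ?_, fun θ => ?_⟩
  · have h1 : ((-Complex.I) ^ N) ^ 2 = 1 ∨ ((-Complex.I) ^ N) ^ 2 = -1 := by
      rw [← pow_mul, mul_comm, pow_mul, neg_sq, Complex.I_sq]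
      exact neg_one_pow_eq_or ℂ N
    rw [mul_pow, inv_pow]
    rcases h1 with h1 | h1 <;> rcases hdet with h2 | h2 <;> rw [h1, h2] <;> norm_num
  · set X : Matrix (Fin k) (Fin k) ℂ :=
      Matrix.of fun i a => Complex.exp (((a : ℂ) - m) * θ i * Complex.I) with hX
    have hC : (((Matrix.of fun a i => hartley m a (θ i)).det : ℝ) : ℂ) =
        X.det * (hartleyMatrix k).det := by
      rw [← Matrix.det_mul, ← Matrix.det_transpose]
      have : ((Matrix.det (Matrix.transpose
          (Matrix.of fun (a : Fin k) i => hartley m a (θ i))) : ℝ) : ℂ) =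
          Complex.ofRealHom (Matrix.det (Matrix.transpose
            (Matrix.of fun (a : Fin k) i => hartley m a (θ i)))) := rfl
      rw [this, RingHom.map_det]
      congr 1
      ext i a
      rw [hartleyMatrix, mul_add, Matrix.mul_smul, Matrix.mul_smul, mul_one]
      simp only [RingHom.mapMatrix_apply, Matrix.map_apply, Matrix.transpose_apply, Matrix.of_apply,
        Matrix.add_apply, Matrix.smul_apply, smul_eq_mul, Complex.ofRealHom_eq_coe, ofReal_hartley,
        Matrix.mul_apply, Matrix.submatrix_apply, id, Matrix.one_apply, mul_ite, mul_one, mul_zero,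
        Finset.sum_ite_eq', Finset.mem_univ, if_true, hX]
      ring
    -- Row i loses the factor exp(-imθ_i), with m = (k - 1)/2; the same factor arises in `hP`, as
    -- each index lies in k - 1 pairs.
    have hV : X.det = (∏ i, Complex.exp (-(θ i / 2) * Complex.I) ^ (k - 1)) *
        (Matrix.vandermonde fun i => Complex.exp (θ i * Complex.I)).det := by
      rw [← Matrix.det_mul_column]
      congr 1
      ext i a
      simp only [hX, Matrix.of_apply, Matrix.vandermonde_apply]
      rw [← Complex.exp_nat_mul, ← Complex.exp_nat_mul, ← Complex.exp_add]
      congr 1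
      have hk1 : ((k - 1 : ℕ) : ℂ) = 2 * m := by simp [hk]
      rw [hk1]
      ring
    have hP : ∏ i : Fin k, ∏ j ∈ Finset.Ioi i,
        (Complex.exp (-(θ i / 2) * Complex.I) * Complex.exp (-(θ j / 2) * Complex.I)) =
        ∏ i, Complex.exp (-(θ i / 2) * Complex.I) ^ (k - 1) := by
      have := Finset.prod_prod_Ioi_mul_eq_prod_prod_off_diag
        (fun (_ : Fin k) i => Complex.exp (-(θ i / 2) * Complex.I))
      rw [this]
      refine Finset.prod_congr rfl fun i _ => ?_
      rw [Finset.prod_const, Finset.card_compl, Finset.card_singleton, Fintype.card_fin]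
    rw [hC, hV, Matrix.det_vandermonde, Complex.ofReal_prod]
    simp_rw [Complex.ofReal_prod, two_sin_eq_exp, Finset.prod_mul_distrib] at hP ⊢
    rw [hP]
    simp_rw [Finset.prod_const]
    rw [Finset.prod_pow_eq_pow_sum, ← hN]
    field_simp

end Trigonometry

/-! ### Signs of permutations and enumerations. -/

section Permutations

open Equiv

/-- Such a permutation acts by the same ρ on both layers, so its sign is a square. -/
theorem sign_eq_one_of_fin_two_fiber {A : Type*} [Fintype A] [DecidableEq A] (τ : Perm (A × Fin 2))
    (h2 : ∀ w, (τ w).2 = w.2) (h1 : ∀ a, (τ (a, 0)).1 = (τ (a, 1)).1) : Perm.sign τ = 1 := by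
  have h1' : ∀ a b, (τ (a, b)).1 = (τ (a, 0)).1 := by
    intro a b
    fin_cases b
    · rfl
    · exact (h1 a).symm
  have hinj : Function.Injective fun a => (τ (a, 0)).1 := by
    intro a a' h
    have : τ (a, 0) = τ (a', 0) := Prod.ext h (by rw [h2, h2])
    simpa using τ.injective this
  let ρ : Perm A := Equiv.ofBijective _ (Finite.injective_iff_bijective.1 hinj)
  have hτ : τ = prodCongrLeft fun _ : Fin 2 => ρ := by
    ext ⟨a, b⟩
    · exact h1' a b
    · exact congrArg Fin.val (h2 (a, b))
  rw [hτ, Perm.sign_prodCongrLeft, Finset.prod_const, Finset.card_univ, Fintype.card_fin,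
    Int.units_sq]

/-- The Leibniz formula indexed by bijections from X, so that the order on X enters only through the
sign. -/
theorem det_eq_sum_equiv {R X : Type*} [CommRing R] [Fintype X] [DecidableEq X] {k : ℕ}
    (o : Fin k ≃ X) (F : Fin k → X → R) :
    (Matrix.of fun a i => F a (o i)).det =
      ∑ S : X ≃ Fin k, ((Perm.sign (o.trans S) : ℤ) : R) * ∏ x, F (S x) x := by
  rw [Matrix.det_apply']
  refine Fintype.sum_equiv (Equiv.equivCongr o (Equiv.refl _)) _ _ fun σ => ?_
  congr 1
  · congr 3
    ext i
    simp
  · exact Fintype.prod_equiv o _ _ fun i => by simp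

theorem sign_trans_perm_trans {X : Type*} [Fintype X] [DecidableEq X] {k : ℕ} (o : Fin k ≃ X)
    (π : Perm X) (C : X ≃ Fin k) :
    Perm.sign (o.trans (π.trans C)) = Perm.sign π * Perm.sign (o.trans C) := by
  have : o.trans (π.trans C) = (o.trans (π.trans o.symm)).trans (o.trans C) := by
    ext i; simp
  rw [this, Perm.sign_trans, mul_comm, ← Equiv.trans_assoc, Perm.sign_trans_trans_symm]

theorem sign_enumeration_mul {X : Type*} {k : ℕ} (o : Fin k ≃ X) (C S : X ≃ Fin k) :
    Perm.sign (o.trans S) = Perm.sign (o.trans C) * Perm.sign (C.symm.trans S) := by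
  have : o.trans S = (o.trans C).trans (C.symm.trans S) := by
    ext i; simp
  rw [this, Perm.sign_trans, mul_comm]

end Permutations

/-! ### Dependence on the linear orders. -/

section Orders

theorem prod_pairs_lt_eq {X R : Type*} [LinearOrder X] [Fintype X] [CommMonoid R] {k : ℕ}
    (o : Fin k ≃o X) (f : X → X → R) :
    ∏ p : X × X with p.1 < p.2, f p.1 p.2 = ∏ i, ∏ j ∈ Finset.Ioi i, f (o i) (o j) := by
  rw [Finset.prod_filter, Fintype.prod_prod_type, ← o.toEquiv.prod_comp]
  refine Finset.prod_congr rfl fun i _ => ?_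
  rw [← o.toEquiv.prod_comp, ← Finset.prod_filter]
  refine Finset.prod_congr ?_ fun _ _ => rfl
  ext j
  simp

theorem orderIso_toEquiv_eq_trans {X Y : Type*} [LinearOrder X] [LinearOrder Y] {k : ℕ}
    (o : Fin k ≃o X) (o' : Fin k ≃o Y) (π : X ≃ Y) (h : ∀ a b, a < b ↔ π a < π b) :
    o'.toEquiv = o.toEquiv.trans π := by
  let p : X ≃o Y := ⟨π, by intro a b; rw [← not_lt, ← not_lt, ← h]⟩
  have : o' = o.trans p := Subsingleton.elim _ _
  rw [this]
  rfl

theorem prod_two_sin_eq_sum_hartley {m : ℕ} {κ : ℂ}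
    (hκ : ∀ θ : Fin (2 * m + 1) → ℝ,
      ((∏ i, ∏ j ∈ Finset.Ioi i, 2 * Real.sin ((θ j - θ i) / 2) : ℝ) : ℂ) =
        κ * ((Matrix.of fun a i => hartley m a (θ i)).det : ℝ))
    {X : Type*} [LinearOrder X] [Fintype X] (o : Fin (2 * m + 1) ≃o X) (θ : X → ℝ) :
    ((∏ p : X × X with p.1 < p.2, 2 * Real.sin ((θ p.2 - θ p.1) / 2) : ℝ) : ℂ) =
      κ * ((∑ S : X ≃ Fin (2 * m + 1), ((Equiv.Perm.sign (o.toEquiv.trans S) : ℤ) : ℝ) *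
        ∏ x, hartley m (S x) (θ x) : ℝ) : ℂ) := by
  rw [prod_pairs_lt_eq o fun a b => 2 * Real.sin ((θ b - θ a) / 2), hκ,
    ← det_eq_sum_equiv o.toEquiv fun a x => hartley m a (θ x)]
  rfl

end Orders

/-! ### Half-edges, colourings and the sum over edge labels. -/

namespace Graph

variable {α β : Type*} {G : Graph α β}

theorem halfEdge_sigma_ext {s t : Σ v : V(G), G.HalfEdge v} (h1 : s.1 = t.1)
    (h2 : s.2.1 = t.2.1) : s = t := by
  obtain ⟨v, h⟩ := s
  obtain ⟨w, h'⟩ := t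
  obtain rfl : v = w := h1
  exact congrArg _ (Subtype.ext h2)

/-- The first half-edge of an edge at a vertex incident with it. -/
def Inc.halfEdge {e : E(G)} {v : V(G)} (h : G.Inc e v) : G.HalfEdge v := ⟨(e, false), h, by simp⟩

theorem Inc.edge_halfEdge {e : E(G)} {v : V(G)} (h : G.Inc e v) : h.halfEdge.edge = e := rfl

theorem HalfEdge.inc {v : V(G)} (h : G.HalfEdge v) : G.Inc h.edge v := h.2.1

/-- Regroups half-edges by edge instead of by vertex: every edge, loop or not, has exactly two. -/
theorem exists_prod_bool_equiv_halfEdge (G : Graph α β) :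
    ∃ Φ : E(G) × Bool ≃ Σ v : V(G), G.HalfEdge v, ∀ p, (Φ p).2.edge = p.1 := by
  classical
  choose x y hxy using fun e : E(G) => G.exists_isLink_of_mem_edgeSet e.2
  let t : ∀ e : E(G), G.HalfEdge ⟨y e, (hxy e).right_mem⟩ := fun e =>
    -- The flag `true` is reserved for the second half of a loop; both halves of an ordinary edge
    -- carry `false`.
    ⟨(e, decide (x e = y e)), (hxy e).inc_right, fun h => by
      have := hxy e
      rw [of_decide_eq_true h] at this
      exact this⟩
  let f : E(G) × Bool → Σ v : V(G), G.HalfEdge v := fun p =>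
    match p with
    | (e, false) => ⟨⟨x e, (hxy e).left_mem⟩, Inc.halfEdge (hxy e).inc_left⟩
    | (e, true) => ⟨⟨y e, (hxy e).right_mem⟩, t e⟩
  have hf : ∀ p, (f p).2.edge = p.1 := by
    rintro ⟨e, b⟩
    cases b <;> rfl
  have hinj : Function.Injective f := by
    rintro ⟨e, b⟩ ⟨e', b'⟩ h
    have he : e = e' := by
      have := hf (e, b)
      rw [h, hf] at this
      exact this.symm
    subst he
    have hne : f (e, true) ≠ f (e, false) := by
      intro h
      have h1 : y e = x e := congrArg (fun s : Σ v : V(G), G.HalfEdge v => (s.1 : α)) h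
      have h2 : decide (x e = y e) = false :=
        congrArg (fun s : Σ v : V(G), G.HalfEdge v => s.2.1.2) h
      exact of_decide_eq_false h2 h1.symm
    cases b <;> cases b'
    · rfl
    · exact absurd h.symm hne
    · exact absurd h hne
    · rfl
  have hsurj : Function.Surjective f := by
    rintro ⟨⟨v, hv⟩, ⟨⟨e, b⟩, hinc, hloop⟩⟩
    have hv' := hinc.eq_or_eq_of_isLink (hxy e)
    change v = x e ∨ v = y e at hv'
    cases b
    · by_cases h : v = x e
      · exact ⟨(e, false), halfEdge_sigma_ext (Subtype.ext h.symm) rfl⟩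
      · have hy := hv'.resolve_left h
        refine ⟨(e, true), halfEdge_sigma_ext (Subtype.ext hy.symm) (Prod.ext rfl ?_)⟩
        exact decide_eq_false fun hl => h (hy.trans hl.symm)
    · have h := hloop rfl
      have h1 : v = x e := h.eq_of_inc (hxy e).inc_left
      have h2 : v = y e := h.eq_of_inc (hxy e).inc_right
      refine ⟨(e, true), halfEdge_sigma_ext (Subtype.ext h2.symm) (Prod.ext rfl ?_)⟩
      exact decide_eq_true (h1.symm.trans h2)
  exact ⟨Equiv.ofBijective f ⟨hinj, hsurj⟩, hf⟩

/-- The colour bijections `S v` at the vertices come from the edge colouring `c`. -/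
def IsInducedBy {k : ℕ} (S : ∀ v : V(G), G.HalfEdge v ≃ Fin k) (c : E(G) → Fin k) : Prop :=
  ∀ v (h : G.HalfEdge v), S v h = c h.edge

theorem sum_prod_hartley_halfEdge [Fintype V(G)] [Fintype E(G)] [DecidableEq E(G)] {m q : ℕ}
    (hq : 2 * m + 1 ≤ q)
    (S : ∀ v : V(G), G.HalfEdge v ≃ Fin (2 * m + 1)) [Decidable (∃ c, IsInducedBy S c)] :
    ∑ y : E(G) → Fin q, ∏ v, ∏ h : G.HalfEdge v,
        hartley m (S v h) (2 * Real.pi * (y h.edge : ℕ) / q) =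
      if ∃ c, IsInducedBy S c then (q : ℝ) ^ Fintype.card E(G) else 0 := by
  obtain ⟨Φ, hΦ⟩ := exists_prod_bool_equiv_halfEdge G
  set s : E(G) × Bool → Fin (2 * m + 1) := fun p => S (Φ p).1 (Φ p).2 with hs
  have hprod : ∀ y : E(G) → Fin q, ∏ v, ∏ h : G.HalfEdge v,
      hartley m (S v h) (2 * Real.pi * (y h.edge : ℕ) / q) =
      ∏ e, hartley m (s (e, true)) (2 * Real.pi * (y e : ℕ) / q) *
        hartley m (s (e, false)) (2 * Real.pi * (y e : ℕ) / q) := by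
    intro y
    rw [← Fintype.prod_sigma' fun (v : V(G)) (h : G.HalfEdge v) =>
      hartley m (S v h) (2 * Real.pi * (y h.edge : ℕ) / q), ← Φ.prod_comp, Fintype.prod_prod_type]
    refine Finset.prod_congr rfl fun e _ => ?_
    rw [Fintype.prod_bool, hΦ, hΦ]
  simp_rw [hprod]
  -- Each edge variable occurs in one factor only, so the sum of products is a product of sums.
  have := Finset.prod_univ_sum (fun _ : E(G) => (Finset.univ : Finset (Fin q)))
    fun e t => hartley m (s (e, true)) (2 * Real.pi * (t : ℕ) / q) *
        hartley m (s (e, false)) (2 * Real.pi * (t : ℕ) / q)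
  rw [Fintype.piFinset_univ] at this
  rw [← this]
  simp_rw [sum_hartley_mul_hartley m q hq]
  have hiff : (∃ c, IsInducedBy S c) ↔ ∀ e, s (e, true) = s (e, false) := by
    constructor
    · rintro ⟨c, hc⟩ e
      simp only [hs]
      rw [hc, hc, hΦ, hΦ]
    · intro h
      refine ⟨fun e => s (e, false), fun v x => ?_⟩
      obtain ⟨⟨e, b⟩, hp⟩ := Φ.surjective ⟨v, x⟩
      have h1 : S v x = s (e, b) := by simp only [hs]; rw [hp]
      have h2 : x.edge = e := by
        have := hΦ (e, b)
        rwa [hp] at this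
      rw [h1, h2]
      cases b
      · rfl
      · exact h e
  split_ifs with h
  · rw [hiff] at h
    simp [h]
  · rw [hiff] at h
    push Not at h
    obtain ⟨e, he⟩ := h
    exact Finset.prod_eq_zero (Finset.mem_univ e) (if_neg he)

/-! ### Colour classes as matchings, and the comparison of signs. -/

theorem IsInducedBy.edge_eq {k : ℕ} {S : ∀ v : V(G), G.HalfEdge v ≃ Fin k} {c : E(G) → Fin k}
    (hS : IsInducedBy S c) {v : V(G)} {e f : E(G)} (he : G.Inc e v) (hf : G.Inc f v)
    (h : c e = c f) : e = f := by
  have : he.halfEdge = hf.halfEdge := (S v).injective (by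
    rw [hS, hS, he.edge_halfEdge, hf.edge_halfEdge, h])
  rw [← he.edge_halfEdge, this, hf.edge_halfEdge]

theorem IsInducedBy.isPerfectMatching [Fintype E(G)] {k : ℕ}
    {S : ∀ v : V(G), G.HalfEdge v ≃ Fin k} {c : E(G) → Fin k}
    (hS : IsInducedBy S c) (i : Fin k) : G.IsPerfectMatching (Finset.univ.filter (c · = i)) := by
  intro v
  refine ⟨(S v).symm i, ?_, fun h hh => ?_⟩
  · simp [← hS v]
  · rw [Equiv.eq_symm_apply, hS]
    simpa using hh

theorem IsPerfectMatching.exists_listsMatching {M : Finset E(G)} (hM : G.IsPerfectMatching M)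
    {n : ℕ} (ν : Fin (n * 2) ≃ V(G)) : ∃ π, G.ListsMatching ν M π := by
  have hends : ∀ e : M, ∃ x y : Fin (n * 2), x < y ∧ G.IsLink (e : E(G)) (ν x) (ν y) := by
    rintro ⟨e, he⟩
    obtain ⟨a, b, hab⟩ := G.exists_isLink_of_mem_edgeSet e.2
    -- A loop in the matching would contribute two half-edges at its vertex.
    have hne : a ≠ b := by
      rintro rfl
      obtain ⟨h, -, hu⟩ := hM ⟨a, hab.left_mem⟩
      have h1 := hu ⟨(e, false), hab.inc_left, by simp⟩ he
      have h2 := hu ⟨(e, true), hab.inc_left, fun _ => hab⟩ he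
      have := congrArg (fun s => s.1.2) (h1.trans h2.symm)
      simp at this
    have ha : (ν (ν.symm ⟨a, hab.left_mem⟩) : α) = a := by simp
    have hb : (ν (ν.symm ⟨b, hab.right_mem⟩) : α) = b := by simp
    rcases lt_trichotomy (ν.symm ⟨a, hab.left_mem⟩) (ν.symm ⟨b, hab.right_mem⟩) with h | h | h
    · exact ⟨_, _, h, by rwa [ha, hb]⟩
    · exact absurd (congrArg Subtype.val (ν.symm.injective h)) hne
    · exact ⟨_, _, h, by rw [ha, hb]; exact hab.symm⟩
  choose lo hi hlt hlink using hends
  let f : M × Fin 2 → Fin (n * 2) := fun p => if p.2 = 0 then lo p.1 else hi p.1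
  have hinc : ∀ p, G.Inc (p.1 : E(G)) (ν (f p)) := by
    intro p
    simp only [f]
    split_ifs
    · exact (hlink _).inc_left
    · exact (hlink _).inc_right
  have hinj : Function.Injective f := by
    rintro ⟨e, b⟩ ⟨e', b'⟩ h
    have he : e = e' := by
      obtain ⟨x, -, hu⟩ := hM (ν (f (e, b)))
      have h1 := hu (hinc (e, b)).halfEdge e.2
      have h2 := hu (Inc.halfEdge (e := e'.1) (by rw [h]; exact hinc (e', b'))) e'.2
      exact Subtype.ext (congrArg HalfEdge.edge (h1.trans h2.symm))
    subst he
    have := hlt e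
    fin_cases b <;> fin_cases b' <;> simp [f] at h ⊢ <;> omega
  have hsurj : Function.Surjective f := by
    intro x
    obtain ⟨h, hm, -⟩ := hM (ν x)
    rcases h.inc.eq_or_eq_of_isLink (hlink ⟨h.edge, hm⟩) with h' | h'
    · exact ⟨(⟨h.edge, hm⟩, 0), ν.injective (Subtype.ext h'.symm)⟩
    · exact ⟨(⟨h.edge, hm⟩, 1), ν.injective (Subtype.ext h'.symm)⟩
  let F := Equiv.ofBijective f ⟨hinj, hsurj⟩
  have hcard : Fintype.card M = n := by
    have := Fintype.card_congr F
    simp only [Fintype.card_prod, Fintype.card_fin] at this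
    omega
  let g : Fin n ≃ M := (Fintype.equivFinOfCardEq hcard).symm
  refine ⟨finProdFinEquiv.symm.trans ((Equiv.prodCongr g (Equiv.refl _)).trans F), fun i => ?_⟩
  have h0 : (finProdFinEquiv.symm.trans ((Equiv.prodCongr g (Equiv.refl _)).trans F))
      (finProdFinEquiv (i, 0)) = lo (g i) := by
    rw [Equiv.trans_apply, Equiv.symm_apply_apply]
    rfl
  have h1 : (finProdFinEquiv.symm.trans ((Equiv.prodCongr g (Equiv.refl _)).trans F))
      (finProdFinEquiv (i, 1)) = hi (g i) := by
    rw [Equiv.trans_apply, Equiv.symm_apply_apply]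
    rfl
  rw [h0, h1]
  exact ⟨hlt _, _, (g i).2, hlink _⟩

/-- An edge has at most one pair of ends `x < y`. -/
theorem IsLink.numbering_unique {N : ℕ} {ν : Fin N ≃ V(G)} {e : β} {x y x' y' : Fin N}
    (h : G.IsLink e (ν x) (ν y)) (h' : G.IsLink e (ν x') (ν y')) (hxy : x < y) (hxy' : x' < y') :
    x = x' ∧ y = y' := by
  rcases h.eq_and_eq_or_eq_and_eq h' with ⟨h1, h2⟩ | ⟨h1, h2⟩
  · exact ⟨ν.injective (Subtype.ext h1), ν.injective (Subtype.ext h2)⟩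
  · have h1 := ν.injective (Subtype.ext h1)
    have h2 := ν.injective (Subtype.ext h2)
    omega

theorem IsInducedBy.link_edge [Fintype E(G)] {k : ℕ} {S : ∀ v : V(G), G.HalfEdge v ≃ Fin k}
    {c : E(G) → Fin k} (hS : IsInducedBy S c) {n : ℕ} {ν : Fin (n * 2) ≃ V(G)} {i : Fin k}
    {π : Equiv.Perm (Fin (n * 2))}
    (hπ : G.ListsMatching ν (Finset.univ.filter (c · = i)) π) (j : Fin n) (b : Fin 2)
    {x : Fin (n * 2)} (hx : π (finProdFinEquiv (j, b)) = x) {h : G.HalfEdge (ν x)}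
    (hh : S (ν x) h = i) :
    G.IsLink h.edge (ν (π (finProdFinEquiv (j, 0)))) (ν (π (finProdFinEquiv (j, 1)))) := by
  obtain ⟨-, e, he, hl⟩ := hπ j
  have hinc : G.Inc e (ν x) := by
    subst hx
    fin_cases b
    · exact hl.inc_left
    · exact hl.inc_right
  have : e = h.edge := hS.edge_eq hinc h.inc (by
    rw [← hS, hh]
    simpa using he)
  rwa [← this]

/-- The permutation τ below sends the place of an edge end in the first listing to its place in the
second. Both listings put the smaller end first, so τ moves whole edges and keeps the end index,
hence is even. Its factors are the listings and, at each vertex, the recolouring. -/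
theorem sign_listings_mul_sign_colorings [Fintype E(G)] {k n : ℕ} (ν : Fin (n * 2) ≃ V(G))
    {S S' : ∀ v : V(G), G.HalfEdge v ≃ Fin k} {c c' : E(G) → Fin k}
    (hS : IsInducedBy S c) (hS' : IsInducedBy S' c') {π π' : Fin k → Equiv.Perm (Fin (n * 2))}
    (hπ : ∀ i, G.ListsMatching ν (Finset.univ.filter (c · = i)) (π i))
    (hπ' : ∀ i, G.ListsMatching ν (Finset.univ.filter (c' · = i)) (π' i)) :
    (∏ i, Equiv.Perm.sign (π i)) * (∏ x, Equiv.Perm.sign ((S (ν x)).symm.trans (S' (ν x)))) *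
      ∏ i, Equiv.Perm.sign (π' i) = 1 := by
  let P : Equiv.Perm (Fin (n * 2) × Fin k) := Equiv.prodCongrLeft π
  let P' : Equiv.Perm (Fin (n * 2) × Fin k) := Equiv.prodCongrLeft π'
  let D : Equiv.Perm (Fin (n * 2) × Fin k) :=
    Equiv.prodCongrRight fun x => (S (ν x)).symm.trans (S' (ν x))
  let θ : (Fin n × Fin k) × Fin 2 ≃ Fin (n * 2) × Fin k :=
    { toFun := fun w => (finProdFinEquiv (w.1.1, w.2), w.1.2)
      invFun := fun z => (((finProdFinEquiv.symm z.1).1, z.2), (finProdFinEquiv.symm z.1).2)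
      left_inv := by rintro ⟨⟨j, i⟩, b⟩; simp
      right_inv := by
        rintro ⟨x, i⟩
        exact Prod.ext (finProdFinEquiv.apply_symm_apply x) rfl }
  set τ : Equiv.Perm ((Fin n × Fin k) × Fin 2) :=
    (θ.trans (P.trans (D.trans P'.symm))).trans θ.symm with hτ
  have key : ∀ j i b, ∃ e : E(G), c e = i ∧ c' e = (τ ((j, i), b)).1.2 ∧
      G.IsLink e (ν (π i (finProdFinEquiv (j, 0)))) (ν (π i (finProdFinEquiv (j, 1)))) ∧
      π' (τ ((j, i), b)).1.2 (finProdFinEquiv ((τ ((j, i), b)).1.1, 0)) =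
        π i (finProdFinEquiv (j, 0)) ∧
      π' (τ ((j, i), b)).1.2 (finProdFinEquiv ((τ ((j, i), b)).1.1, 1)) =
        π i (finProdFinEquiv (j, 1)) ∧
      π' (τ ((j, i), b)).1.2 (finProdFinEquiv ((τ ((j, i), b)).1.1, (τ ((j, i), b)).2)) =
        π i (finProdFinEquiv (j, b)) := by
    intro j i b
    have hw : P' (θ (τ ((j, i), b))) = D (P (θ ((j, i), b))) := by simp [hτ]
    obtain ⟨⟨⟨j', i'⟩, b'⟩, hw'⟩ : ∃ w, τ ((j, i), b) = w := ⟨_, rfl⟩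
    rw [hw'] at hw ⊢
    obtain ⟨hv, hi⟩ := Prod.ext_iff.1 hw
    change π' i' (finProdFinEquiv (j', b')) = π i (finProdFinEquiv (j, b)) at hv
    change i' = S' (ν (π i (finProdFinEquiv (j, b))))
      ((S (ν (π i (finProdFinEquiv (j, b))))).symm i) at hi
    set x := π i (finProdFinEquiv (j, b)) with hx
    set h := (S (ν x)).symm i with hh
    have hSh : S (ν x) h = i := by simp [hh]
    have l := hS.link_edge (hπ i) j b hx.symm hSh
    have l' := hS'.link_edge (hπ' i') j' b' hv hi.symm
    obtain ⟨h0, h1⟩ := l'.numbering_unique l (hπ' i' j').1 (hπ i j).1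
    exact ⟨h.edge, by rw [← hS, hSh], by rw [← hS', ← hi], l, h0, h1, hv⟩
  have hsign : Equiv.Perm.sign τ = 1 := by
    apply sign_eq_one_of_fin_two_fiber
    · rintro ⟨⟨j, i⟩, b⟩
      obtain ⟨e, -, -, -, h0, h1, hb⟩ := key j i b
      have : π' (τ ((j, i), b)).1.2 (finProdFinEquiv ((τ ((j, i), b)).1.1, (τ ((j, i), b)).2)) =
          π' (τ ((j, i), b)).1.2 (finProdFinEquiv ((τ ((j, i), b)).1.1, b)) := by
        rw [hb]
        fin_cases b
        · exact h0.symm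
        · exact h1.symm
      exact (Prod.ext_iff.1 (finProdFinEquiv.injective ((π' _).injective this))).2
    · rintro ⟨j, i⟩
      obtain ⟨e, hc, hc', hl, h0, -, -⟩ := key j i 0
      obtain ⟨f, hf, hf', hl', h0', -, -⟩ := key j i 1
      have hef : e = f := hS.edge_eq hl.inc_left hl'.inc_left (hc.trans hf.symm)
      subst hef
      have hi : (τ ((j, i), 0)).1.2 = (τ ((j, i), 1)).1.2 := hc'.symm.trans hf'
      rw [hi] at h0
      have := finProdFinEquiv.injective ((π' _).injective (h0.trans h0'.symm))
      exact Prod.ext (Prod.ext_iff.1 this).1 hi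
  rw [hτ, Equiv.Perm.sign_trans_trans_symm, Equiv.Perm.sign_trans, Equiv.Perm.sign_trans,
    Equiv.Perm.sign_symm, Equiv.Perm.sign_prodCongrLeft, Equiv.Perm.sign_prodCongrLeft,
    Equiv.Perm.sign_prodCongrRight] at hsign
  rw [← hsign]
  ac_rfl

/-- In a graph with a Pfaffian labelling all proper edge colourings have the same sign. -/
theorem IsPfaffianLabelling.prod_sign_eq_one [Fintype V(G)] [Fintype E(G)] {n k : ℕ}
    {ν : Fin (n * 2) ≃ V(G)} {Γ : Type*} [CommGroup Γ] {negOne : Γ} {l : E(G) → Γ}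
    (hl : G.IsPfaffianLabelling ν negOne l)
    {S S' : ∀ v : V(G), G.HalfEdge v ≃ Fin k} {c c' : E(G) → Fin k}
    (hS : IsInducedBy S c) (hS' : IsInducedBy S' c') :
    ∏ v, Equiv.Perm.sign ((S v).symm.trans (S' v)) = 1 := by
  obtain ⟨hord, hl⟩ := hl
  have hsq : negOne * negOne = 1 := by rw [← sq, ← hord, pow_orderOf_eq_one]
  have hne : negOne ≠ 1 := by
    rintro rfl
    simp at hord
  let s : ℤˣ →* Γ :=
    { toFun := fun u => if u = 1 then 1 else negOne
      map_one' := by simp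
      map_mul' := by
        intro a b
        rcases Int.units_eq_one_or a with rfl | rfl <;>
        rcases Int.units_eq_one_or b with rfl | rfl <;> simp [hsq] }
  have hsinj : Function.Injective s := by
    intro a b h
    rcases Int.units_eq_one_or a with rfl | rfl <;>
    rcases Int.units_eq_one_or b with rfl | rfl <;> simp [s, hne, hne.symm] at h ⊢
  -- The colour classes partition the edges, so the right side does not involve the colouring.
  have hprod : ∀ (c : E(G) → Fin k) (π : Fin k → Equiv.Perm (Fin (n * 2))),
      (∀ i, G.IsPerfectMatching (Finset.univ.filter (c · = i))) →
      (∀ i, G.ListsMatching ν (Finset.univ.filter (c · = i)) (π i)) →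
      s (∏ i, Equiv.Perm.sign (π i)) = ∏ e, l e := by
    intro c π hM hπ
    rw [map_prod, ← Finset.prod_fiberwise Finset.univ c l]
    exact Finset.prod_congr rfl fun i _ => (hl _ (hM i) _ (hπ i)).symm
  choose π hπ using fun i => (hS.isPerfectMatching i).exists_listsMatching ν
  choose π' hπ' using fun i => (hS'.isPerfectMatching i).exists_listsMatching ν
  have heq : ∏ i, Equiv.Perm.sign (π i) = ∏ i, Equiv.Perm.sign (π' i) := hsinj
    ((hprod c π hS.isPerfectMatching hπ).trans (hprod c' π' hS'.isPerfectMatching hπ').symm)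
  have := sign_listings_mul_sign_colorings ν hS hS' hπ hπ'
  rw [heq, mul_right_comm, Int.units_mul_self, one_mul] at this
  rw [← this]
  exact (ν.prod_comp fun v => Equiv.Perm.sign ((S v).symm.trans (S' v))).symm

/-- With k half-edges and k colours at each vertex, injective means bijective; the colouring is
recovered because every edge has an end. -/
theorem numProperEdgeColorings_eq_card [Fintype V(G)] [Fintype E(G)] {k : ℕ}
    (hG : ∀ v : V(G), Fintype.card (G.HalfEdge v) = k) :
    G.numProperEdgeColorings k =
      Nat.card {S : ∀ v : V(G), G.HalfEdge v ≃ Fin k // ∃ c, IsInducedBy S c} := by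
  refine Nat.card_congr (Equiv.ofBijective
    (fun c => ⟨fun v => Equiv.ofBijective _ ((Fintype.bijective_iff_injective_and_card _).2
      ⟨c.2 v, by rw [hG, Fintype.card_fin]⟩), c.1, fun _ _ => rfl⟩) ⟨?_, ?_⟩)
  · rintro ⟨c, hc⟩ ⟨c', hc'⟩ h
    ext e : 2
    obtain ⟨a, b, hab⟩ := G.exists_isLink_of_mem_edgeSet e.2
    have h1 := congrFun (congrArg Subtype.val h) ⟨a, hab.left_mem⟩
    exact Equiv.congr_fun h1 (Inc.halfEdge hab.inc_left)
  · rintro ⟨S, c, hc⟩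
    refine ⟨⟨c, fun v => ?_⟩, Subtype.ext (funext fun v => Equiv.ext fun h => (hc v h).symm)⟩
    have : (fun h : G.HalfEdge v => c h.edge) = S v := funext fun h => (hc v h).symm
    rw [this]
    exact (S v).injective

end Graph

/-! ### Assembling the identity. -/

namespace Graph

variable {α β : Type*} {G : Graph α β}

/-- The sum over all labellings counts, up to a constant, the signed edge colourings. -/
theorem sum_prod_two_sin_eq [Fintype V(G)] [DecidableEq V(G)] [Fintype E(G)] [DecidableEq E(G)] {m q : ℕ}
    (hq : 2 * m + 1 ≤ q) {κ : ℂ}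
    (hκ : ∀ θ : Fin (2 * m + 1) → ℝ,
      ((∏ i, ∏ j ∈ Finset.Ioi i, 2 * Real.sin ((θ j - θ i) / 2) : ℝ) : ℂ) =
        κ * ((Matrix.of fun a i => hartley m a (θ i)).det : ℝ))
    (ord : ∀ v : V(G), LinearOrder (G.HalfEdge v))
    (o : ∀ v : V(G), Fin (2 * m + 1) ≃o G.HalfEdge v) [DecidablePred
      fun S : ∀ v : V(G), G.HalfEdge v ≃ Fin (2 * m + 1) => ∃ c, IsInducedBy S c] :
    ((∑ y : E(G) → Fin q, ∏ v : V(G), ∏ p : G.HalfEdge v × G.HalfEdge v with p.1 < p.2,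
        2 * Real.sin (Real.pi * (((y p.2.edge : ℕ) : ℝ) - ((y p.1.edge : ℕ) : ℝ)) / (q : ℝ)) : ℝ) :
          ℂ) =
      κ ^ Fintype.card V(G) * ((q : ℂ) ^ Fintype.card E(G) *
        ∑ S : ∀ v : V(G), G.HalfEdge v ≃ Fin (2 * m + 1) with ∃ c, IsInducedBy S c,
          ((∏ v, Equiv.Perm.sign ((o v).toEquiv.trans (S v)) : ℤˣ) : ℤ)) := by
  have hvertex : ∀ (y : E(G) → Fin q) (v : V(G)),
      ((∏ p : G.HalfEdge v × G.HalfEdge v with p.1 < p.2, 2 * Real.sin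
        (Real.pi * (((y p.2.edge : ℕ) : ℝ) - ((y p.1.edge : ℕ) : ℝ)) / (q : ℝ)) : ℝ) : ℂ) =
      κ * ((∑ S : G.HalfEdge v ≃ Fin (2 * m + 1),
        ((Equiv.Perm.sign ((o v).toEquiv.trans S) : ℤ) : ℝ) *
          ∏ h, hartley m (S h) (2 * Real.pi * (y h.edge : ℕ) / q) : ℝ) : ℂ) := by
    intro y v
    rw [← prod_two_sin_eq_sum_hartley hκ (o v) fun h => 2 * Real.pi * (y h.edge : ℕ) / q]
    congr 1
    refine Finset.prod_congr rfl fun p _ => ?_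
    congr 2
    ring
  rw [Complex.ofReal_sum]
  simp_rw [Complex.ofReal_prod _ (fun v : V(G) => _), hvertex, Finset.prod_mul_distrib,
    Finset.prod_const, Finset.card_univ]
  rw [← Finset.mul_sum]
  congr 1
  -- The product over vertices of sums over bijections becomes one sum over families, which is then
  -- exchanged with the sum over y.
  simp_rw [← Complex.ofReal_prod, Finset.prod_univ_sum, Fintype.piFinset_univ,
    Finset.prod_mul_distrib]
  rw [← Complex.ofReal_sum, Finset.sum_comm]
  simp_rw [← Finset.mul_sum, sum_prod_hartley_halfEdge hq]
  simp_rw [mul_ite, mul_zero]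
  rw [← Finset.sum_filter, ← Finset.sum_mul]
  push_cast
  rw [mul_comm]

/-- Fixes a reference family independent of the orders and of q. If no colouring exists any family
will do, since the count is zero. -/
theorem exists_reference_coloring [Fintype V(G)] [Fintype E(G)] {k : ℕ}
    (hG : ∀ v : V(G), Fintype.card (G.HalfEdge v) = k) :
    ∃ C : ∀ v : V(G), G.HalfEdge v ≃ Fin k,
      (∃ S : ∀ v : V(G), G.HalfEdge v ≃ Fin k, ∃ c, IsInducedBy S c) → ∃ c, IsInducedBy C c := by
  by_cases h : ∃ S : ∀ v : V(G), G.HalfEdge v ≃ Fin k, ∃ c, IsInducedBy S c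
  · obtain ⟨S, hS⟩ := h
    exact ⟨S, fun _ => hS⟩
  · exact ⟨fun v => Fintype.equivFinOfCardEq (hG v), fun h' => absurd h' h⟩

end Graph

theorem theorem4p10 {α : Type u} {β : Type v} (G : Graph α β)
    [Fintype V(G)] [Fintype E(G)] [DecidableEq E(G)]
    (k : ℕ) (hk : Odd k) (hreg : G.IsRegular k)
    (hpf : Graph.AdmitsPfaffianLabelling.{u, v, w} G) :
    -- the sign, a function of the orders of the half-edges at the vertices (and not of `q`)
    ∃ ε : (∀ v : V(G), LinearOrder (G.HalfEdge v)) → ℤˣ,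
      -- if permutations `π v` carry one set of orders to another, the sign changes by their signs
      (∀ (ord ord' : ∀ v : V(G), LinearOrder (G.HalfEdge v))
          (π : ∀ v : V(G), Equiv.Perm (G.HalfEdge v)),
        (∀ v h h', (ord v).lt h h' ↔ (ord' v).lt (π v h) (π v h')) →
          ε ord' = (∏ v, Equiv.Perm.sign (π v)) * ε ord) ∧
      ∀ (ord : ∀ v : V(G), LinearOrder (G.HalfEdge v)) (q : ℕ), k ≤ q →
        ((ε ord : ℤ) : ℝ) * (G.numProperEdgeColorings k : ℝ) =
          ((q : ℝ) ^ Fintype.card E(G))⁻¹ *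
            ∑ y : E(G) → Fin q, ∏ v : V(G),
              ∏ p : G.HalfEdge v × G.HalfEdge v with p.1 < p.2,
                2 * Real.sin (Real.pi * (((y p.2.edge : ℕ) : ℝ) - ((y p.1.edge : ℕ) : ℝ)) / (q : ℝ))
    := by
  classical
  obtain ⟨m, rfl⟩ := hk
  have hG : ∀ v : V(G), Fintype.card (G.HalfEdge v) = 2 * m + 1 := fun v => by
    rw [← Nat.card_eq_fintype_card, hreg v]
  obtain ⟨n, ν, Γ, _, negOne, l, hl⟩ := hpf
  obtain ⟨κ, hκ2, hκ⟩ := exists_prod_two_sin_eq_det_hartley m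
  -- The number of vertices is 2n, so only κ² = ±1 matters.
  obtain ⟨s, hs⟩ : ∃ s : ℤˣ, κ ^ Fintype.card V(G) = ((s : ℤ) : ℂ) := by
    obtain ⟨s, hs⟩ : ∃ s : ℤˣ, κ ^ 2 = ((s : ℤ) : ℂ) := by
      rcases hκ2 with h | h
      · exact ⟨1, by simpa using h⟩
      · exact ⟨-1, by simpa using h⟩
    refine ⟨s ^ n, ?_⟩
    rw [← Fintype.card_congr ν, Fintype.card_fin, mul_comm, pow_mul, hs]
    push_cast
    rfl
  obtain ⟨C, hC⟩ := Graph.exists_reference_coloring hG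
  let o : ∀ (ord : ∀ v : V(G), LinearOrder (G.HalfEdge v)) (v : V(G)),
      Fin (2 * m + 1) ≃o G.HalfEdge v := fun ord v => Fintype.orderIsoFinOfCardEq _ (hG v)
  refine ⟨fun ord => s * ∏ v, Equiv.Perm.sign ((o ord v).toEquiv.trans (C v)), ?_, ?_⟩
  · intro ord ord' π hπ
    have ho : ∀ v, (o ord' v).toEquiv = (o ord v).toEquiv.trans (π v) := fun v =>
      @orderIso_toEquiv_eq_trans _ _ (ord v) (ord' v) _ (o ord v) (o ord' v) (π v) (hπ v)
    simp_rw [ho, Equiv.trans_assoc, sign_trans_perm_trans, Finset.prod_mul_distrib]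
    rw [mul_left_comm]
  · intro ord q hq
    have hsum := Graph.sum_prod_two_sin_eq hq hκ ord (o ord)
    have hconst : ∀ S ∈ (Finset.univ.filter fun S : ∀ v : V(G), G.HalfEdge v ≃ Fin (2 * m + 1) =>
        ∃ c, Graph.IsInducedBy S c),
        ((∏ v, Equiv.Perm.sign ((o ord v).toEquiv.trans (S v)) : ℤˣ) : ℤ) =
          ((∏ v, Equiv.Perm.sign ((o ord v).toEquiv.trans (C v)) : ℤˣ) : ℤ) := by
      intro S hS
      obtain ⟨c, hc⟩ := (Finset.mem_filter.1 hS).2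
      obtain ⟨c', hc'⟩ := hC ⟨S, c, hc⟩
      congr 1
      -- The orders cancel in the comparison of S with C, leaving the relative sign, which the
      -- Pfaffian labelling forces to be 1.
      simp_rw [fun v => sign_enumeration_mul (o ord v).toEquiv (C v) (S v)]
      rw [Finset.prod_mul_distrib, hl.prod_sign_eq_one hc' hc, mul_one]
    rw [Finset.sum_congr rfl hconst, Finset.sum_const, hs] at hsum
    have hq0 : (q : ℝ) ^ Fintype.card E(G) ≠ 0 := pow_ne_zero _ (by
      have : 0 < q := by omega
      exact_mod_cast this.ne')
    rw [Graph.numProperEdgeColorings_eq_card hG, Nat.card_eq_fintype_card, Fintype.card_subtype,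
      eq_inv_mul_iff_mul_eq₀ hq0]
    apply Complex.ofReal_injective
    rw [hsum, nsmul_eq_mul]
    push_cast
    ring
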